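/- Let $\Bbbk$ be a field of characteristic $0$ and let $A$ be an associative unital $\Bbbk$-algebra with few automorphisms. That is, the group $\mathrm{Aut}_{\rm Alg}A$ of $\Bbbk$-algebra automorphisms of $A$ satisfies: (i) there is a finite dimensional $\mathrm{Aut}_{\rm Alg}A$-invariant subspace $V\subseteq A$ such that the restriction $\mathrm{Aut}_{\rm Alg}A\to GL(V)$ is injective, and $\mathrm{Aut}_{\rm Alg}A$ is identified with its image in $GL(V)$; (ii) $\mathrm{Aut}_{\rm Alg}A$ is an algebraic (i.e. Zariski closed) subgroup of $GL(V)$; (iii) the action of $\mathrm{Aut}_{\rm Alg}A$ on $A$ is rational, i.e. $A$ is a union of finite dimensional invariant subspaces on which the matrix coefficients of the action are regular functions on $\mathrm{Aut}_{\rm Alg}A$; (iv) the Zariski connected component $(\mathrm{Aut}_{\rm Alg}A)_0$ of the identity is isomorphic, as an algebraic group, to a torus $(\Bbbk^{\times})^r$. Fix $V$ and an isomorphism $\tau:(\Bbbk^{\times})^r\to(\mathrm{Aut}_{\rm Alg}A)_0$ as above, and for $m\in\mathbb Z^r$ put $$A_{(m)}=\{a\in A:\ \tau(s)(a)=s_1^{m_1}\cdots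 s_r^{m_r}\,a\ \text{ for all } s\in(\Bbbk^{\times})^r\}.$$ Then $A=\bigoplus_{m\in\mathbb Z^r}A_{(m)}$ is an algebra grading of $A$ (the canonical grading). Moreover, for every $t\ge 0$ and every algebra grading $A=\bigoplus_{n\in\mathbb Z^t}A_n$ of $A$ there is a group homomorphism $\varphi:\mathbb Z^r\to\mathbb Z^t$ such that $$A_n=\bigoplus_{m\in\mathbb Z^r:\ \varphi(m)=n}A_{(m)}\qquad\text{for all } n\in\mathbb Z^t.$$ -/

import Mathlib

/-! Classical (rational points) language of linear algebraic groups over a field `k`, and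
associative algebras with few automorphisms. -/

section GeneralLinear

variable (k : Type*) [Field k] (V : Type*) [AddCommGroup V] [Module k V]

/-- The coordinate ring of the algebraic group `GL(V)`, `V` finite dimensional, as an algebra of
functions on `GL(V)`: it is generated by the matrix coefficients `g ↦ ξ (g v)` and by the inverse
of the determinant. -/
def glRegularFunctions : Subalgebra k ((V ≃ₗ[k] V) → k) :=
  Algebra.adjoin k
    ({F | ∃ (ξ : Module.Dual k V) (v : V), F = fun g => ξ (g v)} ∪
      {fun g : V ≃ₗ[k] V => (LinearMap.det (g : V →ₗ[k] V))⁻¹})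

/-- The Zariski topology of `GL(V)`: the non-vanishing loci of regular functions form a basis of
open sets. -/
@[reducible]
def glZariski : TopologicalSpace (V ≃ₗ[k] V) :=
  TopologicalSpace.generateFrom {U | ∃ F ∈ glRegularFunctions k V, U = {g | F g ≠ 0}}

end GeneralLinear

section Torus

variable (k : Type*) [Field k] (r : ℕ)

/-- The coordinate ring of the torus `(kˣ)^r`, as an algebra of functions on `(kˣ)^r`: the Laurent
polynomial functions. -/
def torusRegularFunctions : Subalgebra k ((Fin r → kˣ) → k) :=
  Algebra.adjoin k
    ({p | ∃ i : Fin r, p = fun t : Fin r → kˣ => (t i : k)} ∪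
      {p | ∃ i : Fin r, p = fun t : Fin r → kˣ => (t i : k)⁻¹})

variable {k r}

/-- The rational character `t ↦ t₁^{m₁} ⋯ t_r^{m_r}` of the torus `(kˣ)^r` attached to
`m ∈ ℤ^r`. -/
def torusCharacter (m : Fin r → ℤ) (t : Fin r → kˣ) : kˣ :=
  ∏ i, t i ^ m i

end Torus

section Automorphisms

variable {k : Type*} [Field k] {A : Type*} [Ring A] [Algebra k A]

/-- The subspace `V` of `A` is stable under all algebra automorphisms of `A`. -/
def AutInvariant (V : Submodule k A) : Prop :=
  ∀ (g : A ≃ₐ[k] A), ∀ v ∈ V, g v ∈ V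

/-- The restriction homomorphism `Aut(A) → GL(V)` for an `Aut(A)`-stable subspace `V`. -/
def autRestrict {V : Submodule k A} (hV : AutInvariant V) :
    (A ≃ₐ[k] A) →* (V ≃ₗ[k] V) where
  toFun g :=
    { toFun := fun v => ⟨g v, hV g v v.2⟩
      invFun := fun v => ⟨g.symm v, hV g.symm v v.2⟩
      map_add' := fun v w => Subtype.ext (by simp)
      map_smul' := fun c v => Subtype.ext (by simp)
      left_inv := fun v => Subtype.ext (by simp)
      right_inv := fun v => Subtype.ext (by simp) }
  map_one' := rfl
  map_mul' _ _ := rfl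

/-- The regular functions on `Aut(A)`, when `Aut(A)` is identified with its image in `GL(V)`: the
restrictions of the regular functions on `GL(V)`. -/
def autRegularFunctions {V : Submodule k A} (hV : AutInvariant V) : Set ((A ≃ₐ[k] A) → k) :=
  {f | ∃ F ∈ glRegularFunctions k V, f = F ∘ autRestrict hV}

/-- The Zariski topology of `Aut(A)`, when `Aut(A)` is identified with its image in `GL(V)`. -/
@[reducible]
def autZariski {V : Submodule k A} (hV : AutInvariant V) : TopologicalSpace (A ≃ₐ[k] A) :=
  TopologicalSpace.induced (autRestrict hV) (glZariski k V)

/-- The connected component of the identity of `Aut(A)`, for the Zariski topology. -/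
def autIdentityComponent {V : Submodule k A} (hV : AutInvariant V) : Set (A ≃ₐ[k] A) :=
  @connectedComponent (A ≃ₐ[k] A) (autZariski hV) 1

/-- The action of `Aut(A)` on `A` is rational: `A` is the union of finite dimensional stable
subspaces on which the matrix coefficients are regular functions on `Aut(A)`. (A linear form on a
subspace is the restriction of a linear form `ξ` on `A`.) -/
def AutActsRationally {V : Submodule k A} (hV : AutInvariant V) : Prop :=
  ∀ a : A, ∃ W : Submodule k A, a ∈ W ∧ FiniteDimensional k W ∧ AutInvariant W ∧
    ∀ w ∈ W, ∀ ξ : Module.Dual k A, (fun g : A ≃ₐ[k] A => ξ (g w)) ∈ autRegularFunctions hV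

variable (k A)

/-- An algebra with few automorphisms, together with the choices occurring in that notion: the
subspace `V` and the isomorphism of the identity component of `Aut(A)` with a torus `(kˣ)^r`. -/
structure FewAutomorphisms where
  /-- the finite dimensional `Aut(A)`-stable subspace -/
  V : Submodule k A
  finiteDimensional : FiniteDimensional k V
  invariant : AutInvariant V
  /-- `Aut(A)` is identified with a subgroup of `GL(V)` -/
  restrict_injective : Function.Injective (autRestrict invariant)
  /-- this subgroup is algebraic, that is Zariski closed -/
  isClosed_range : @IsClosed (V ≃ₗ[k] V) (glZariski k V) (Set.range (autRestrict invariant))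
  rational : AutActsRationally invariant
  /-- the rank of the torus -/
  r : ℕ
  /-- the isomorphism from the torus onto the identity component -/
  torus : (Fin r → kˣ) →* (A ≃ₐ[k] A)
  torus_injective : Function.Injective torus
  range_torus : Set.range torus = autIdentityComponent invariant
  /-- `torus` is an isomorphism of varieties onto its image: it identifies the regular functions on
  the identity component (restrictions of regular functions on `Aut(A)`) with those on
  the torus -/
  torus_regular : ∀ p : (Fin r → kˣ) → k,
    p ∈ torusRegularFunctions k r ↔ ∃ f ∈ autRegularFunctions invariant, p = f ∘ torus

variable {k A}

/-- The component `A_(m)`, `m ∈ ℤ^r`, of the canonical grading of an algebra with few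
automorphisms: the isotypic component of type `m` for the action of the identity component of
`Aut(A)`, identified with `(kˣ)^r`. -/
def FewAutomorphisms.canonical (h : FewAutomorphisms k A) (m : Fin h.r → ℤ) : Submodule k A where
  carrier := {a | ∀ t : Fin h.r → kˣ, h.torus t a = (torusCharacter m t : k) • a}
  add_mem' := fun ha hb t => by rw [map_add, ha t, hb t, smul_add]
  zero_mem' := fun t => by rw [map_zero, smul_zero]
  smul_mem' := fun c a ha t => by rw [map_smul, ha t, smul_comm]

/-- The subspace `W` is the (internal) direct sum of the family of subspaces `U`. -/
def IsDirectSumOf {ι : Type*} (W : Submodule k A) (U : ι → Submodule k A) : Prop :=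
  iSupIndep U ∧ W = ⨆ i, U i

end Automorphisms


/-! The torus acts on each finite dimensional stable subspace through matrix coefficients that are
combinations of its characters, which gives the canonical decomposition.

A grading of `A` by a group `Γ` of characters of a group `G` is an action of `G` on `A` by algebra
automorphisms whose matrix coefficients lie in the span `k[Γ]` of these characters; the action
pulls the regular functions on `Aut(A)` back into `k[Γ]`. If `k[Γ]` is a domain, then `G` is
irreducible, hence connected, for the topology defined by `k[Γ]`, so it acts through the identity
component, that is through a homomorphism `θ : G → (kˣ)^r`. The pullback along `θ` of the character
`m` of the torus is a character of `G` lying in `k[Γ]`, hence, characters being linearly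
independent, an element `φ m` of `Γ`. Therefore `A_(m)` lies in the component of degree `φ m`. For
`Γ = ℤ^t` one takes `G = (kˣ)^t`. -/

theorem eq_iSup_fiber_of_le {α ι κ : Type*} [CompleteLattice α] [IsModularLattice α]
    {P : ι → α} {Q : κ → α} (hP : ⨆ i, P i = ⊤) (hQ : iSupIndep Q) {φ : ι → κ}
    (hle : ∀ i, P i ≤ Q (φ i)) (n : κ) : Q n = ⨆ i : {i // φ i = n}, P i := by
  have hfiber : (fun n => ⨆ i : {i // φ i = n}, P i) ≤ Q := fun n =>
    iSup_le fun i => (hle i).trans_eq (congrArg Q i.2)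
  have htop : ⨆ n, ⨆ i : {i // φ i = n}, P i = ⊤ := top_unique <| hP ▸ iSup_le fun i =>
    le_iSup_of_le (φ i) (le_iSup (fun j : {j // φ j = φ i} => P j) ⟨i, rfl⟩)
  exact (congrFun ((hQ.le_iff_eq_of_iSup_eq_top htop).1 hfiber) n).symm

section CharacterSpaces

variable {k G M ι : Type*} [Field k] [Monoid G] [AddCommGroup M] [Module k M]

theorem eq_zero_of_forall_sum_character_smul_eq_zero {χ : ι → G →* k}
    (hχ : Function.Injective χ) {s : Finset ι} {v : ι → M}
    (hv : ∀ g, ∑ i ∈ s, χ i g • v i = 0) : ∀ i ∈ s, v i = 0 := by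
  intro i hi
  refine (Module.forall_dual_apply_eq_zero_iff k _).1 fun ξ => ?_
  have hindep : LinearIndependent k fun i => (χ i : G → k) :=
    (linearIndependent_monoidHom G k).comp χ hχ
  refine linearIndependent_iff'.1 hindep s (fun i => ξ (v i)) (funext fun g => ?_) i hi
  simpa [mul_comm] using congrArg ξ (hv g)

/-- The isotypic component of type `χ` of a representation, for a character `χ` of the group. -/
def characterSpace (ρ : Representation k G M) (χ : G →* k) : Submodule k M :=
  ⨅ g, Module.End.eigenspace (ρ g) (χ g)

theorem mem_characterSpace {ρ : Representation k G M} {χ : G →* k} {a : M} :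
    a ∈ characterSpace ρ χ ↔ ∀ g, ρ g a = χ g • a := by
  simp [characterSpace]

theorem iSupIndep_characterSpace (ρ : Representation k G M) {χ : ι → G →* k}
    (hχ : Function.Injective χ) : iSupIndep fun i => characterSpace ρ (χ i) := by
  refine (iSupIndep_iff_finsetSum_eq_zero_imp_eq_zero _).2 fun s v hv hsum => ?_
  refine eq_zero_of_forall_sum_character_smul_eq_zero hχ fun g => ?_
  rw [← map_zero (ρ g), ← hsum, map_sum]
  exact Finset.sum_congr rfl fun i hi => (mem_characterSpace.1 (hv i hi) g).symm

theorem mem_characterSpace_of_forall_eq_sum {ρ : Representation k G M} {χ : ι → G →* k}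
    (hχ : Function.Injective χ) {w : M} {s : Finset ι} {v : ι → M}
    (hw : ∀ g, ρ g w = ∑ i ∈ s, χ i g • v i) {i : ι} (hi : i ∈ s) :
    v i ∈ characterSpace ρ (χ i) := by
  refine mem_characterSpace.2 fun g => sub_eq_zero.1 ?_
  refine eq_zero_of_forall_sum_character_smul_eq_zero hχ
    (v := fun i => ρ g (v i) - χ i g • v i) (fun g' => ?_) i hi
  have hmul : ∑ i ∈ s, χ i g' • ρ g (v i) = ∑ i ∈ s, χ i (g * g') • v i := by
    rw [← hw, map_mul, Module.End.mul_apply, hw, map_sum]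
    simp only [map_smul]
  simp only [smul_sub, Finset.sum_sub_distrib, hmul, smul_smul, map_mul, mul_comm, sub_self]

theorem exists_eq_sum_smul_of_forall_dual_mem_span {X : Type*} {e : ι → X → k}
    (W : Submodule k M) [FiniteDimensional k W] {F : X → M} (hF : ∀ x, F x ∈ W)
    (hspan : ∀ ξ : Module.Dual k M, (fun x => ξ (F x)) ∈ Submodule.span k (Set.range e)) :
    ∃ (s : Finset ι) (v : ι → M), ∀ x, F x = ∑ i ∈ s, e i x • v i := by
  classical
  let b := Module.finBasis k W
  choose ξ hξ using fun j => LinearMap.exists_extend (b.coord j)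
  choose c hc using fun j => Finsupp.mem_span_range_iff_exists_finsupp.1 (hspan (ξ j))
  let s := Finset.univ.biUnion fun j => (c j).support
  have hcoord (j) (x : X) : ξ j (F x) = ∑ i ∈ s, c j i * e i x := by
    rw [← congrFun (hc j) x, Finsupp.sum_of_support_subset (s := s) _
      (Finset.subset_biUnion_of_mem (fun j => (c j).support) (Finset.mem_univ j)) _ (by simp)]
    simp
  have hexpand (x : X) : F x = ∑ j, ξ j (F x) • (b j : M) := by
    have hrepr (j) : ξ j (F x) = b.repr ⟨F x, hF x⟩ j := LinearMap.congr_fun (hξ j) ⟨F x, hF x⟩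
    have hsum := congrArg Subtype.val (b.sum_repr ⟨F x, hF x⟩)
    simp only [Submodule.coe_sum, Submodule.coe_smul] at hsum
    simp only [hrepr, hsum]
  refine ⟨s, fun i => ∑ j, c j i • (b j : M), fun x => ?_⟩
  calc F x = ∑ j, ∑ i ∈ s, (c j i * e i x) • (b j : M) := by
        rw [hexpand x]
        simp only [hcoord, Finset.sum_smul]
    _ = ∑ i ∈ s, e i x • ∑ j, c j i • (b j : M) := by
        rw [Finset.sum_comm]
        simp only [Finset.smul_sum, smul_smul, mul_comm]

theorem mem_iSup_characterSpace (ρ : Representation k G M) {χ : ι → G →* k}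
    (hχ : Function.Injective χ) (W : Submodule k M) [FiniteDimensional k W] {w : M}
    (hW : ∀ g, ρ g w ∈ W)
    (hspan : ∀ ξ : Module.Dual k M,
      (fun g => ξ (ρ g w)) ∈ Submodule.span k (Set.range fun i => (χ i : G → k))) :
    w ∈ ⨆ i, characterSpace ρ (χ i) := by
  obtain ⟨s, v, hv⟩ := exists_eq_sum_smul_of_forall_dual_mem_span W hW hspan
  have hw : w = ∑ i ∈ s, v i := by simpa using hv 1
  rw [hw]
  exact sum_mem fun i hi =>
    Submodule.mem_iSup_of_mem i (mem_characterSpace_of_forall_eq_sum hχ hv hi)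

end CharacterSpaces

section CharacterAlgebra

variable {k X G : Type*} [Field k]

/-- The algebra of functions on `G` spanned by a monoid of characters, itself given as the image of
a homomorphism `χ`. For independent characters it is a copy of the monoid algebra of `X`, and plays
the role of the coordinate ring of the diagonalizable group with character group `X`. -/
noncomputable def characterAlgebra [Monoid X] [Monoid G] (χ : X →* G →* k) : Subalgebra k (G → k) :=
  (MonoidAlgebra.lift k (G → k) X ((MonoidHom.coeFn G k).comp χ)).range

section Monoid

variable [Monoid X] [Monoid G] {χ : X →* G →* k}

theorem lift_coeFn_comp_eq_linearCombination (χ : X →* G →* k) (p : MonoidAlgebra k X) :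
    MonoidAlgebra.lift k (G → k) X ((MonoidHom.coeFn G k).comp χ) p =
      Finsupp.linearCombination k (fun x => (χ x : G → k)) p.coeff :=
  MonoidAlgebra.lift_apply _ _

theorem toSubmodule_characterAlgebra (χ : X →* G →* k) :
    Subalgebra.toSubmodule (characterAlgebra χ) =
      Submodule.span k (Set.range fun x => (χ x : G → k)) := by
  ext f
  rw [Finsupp.mem_span_range_iff_exists_finsupp]
  exact ⟨fun ⟨p, hp⟩ => ⟨p.coeff, (lift_coeFn_comp_eq_linearCombination χ p).symm.trans hp⟩,
    fun ⟨c, hc⟩ => ⟨.ofCoeff c, (lift_coeFn_comp_eq_linearCombination χ _).trans hc⟩⟩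

theorem coe_mem_characterAlgebra (χ : X →* G →* k) (x : X) :
    (χ x : G → k) ∈ characterAlgebra χ :=
  ⟨MonoidAlgebra.of k X x, MonoidAlgebra.lift_of _ _⟩

theorem noZeroDivisors_characterAlgebra [UniqueProds X] (hχ : Function.Injective χ) :
    NoZeroDivisors (characterAlgebra χ) := by
  have hindep : LinearIndependent k fun x => (χ x : G → k) :=
    (linearIndependent_monoidHom G k).comp χ hχ
  have hinj : Function.Injective
      (MonoidAlgebra.lift k (G → k) X ((MonoidHom.coeFn G k).comp χ)) := fun p q hpq => by
    rw [lift_coeFn_comp_eq_linearCombination, lift_coeFn_comp_eq_linearCombination] at hpq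
    exact MonoidAlgebra.coeff_injective (hindep.finsuppLinearCombination_injective hpq)
  exact (AlgEquiv.ofInjective _ hinj).symm.injective.noZeroDivisors _ (map_zero _) (map_mul _)

theorem exists_eq_of_coe_mem_characterAlgebra {ψ : G →* k}
    (hψ : (ψ : G → k) ∈ characterAlgebra χ) : ∃ x, χ x = ψ := by
  rw [← Subalgebra.mem_toSubmodule, toSubmodule_characterAlgebra] at hψ
  by_contra hne
  refine (linearIndependent_monoidHom G k).notMem_span_image (s := Set.range χ) (x := ψ) hne ?_
  rwa [← Set.range_comp]

theorem exists_comp_eq_of_forall_mem_characterAlgebra {Y : Type*} [Monoid Y]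
    (hχ : Function.Injective χ) {η : Y →* G →* k}
    (hη : ∀ y, (η y : G → k) ∈ characterAlgebra χ) : ∃ φ : Y →* X, χ.comp φ = η := by
  choose φ hφ using fun y => exists_eq_of_coe_mem_characterAlgebra (hη y)
  exact ⟨{ toFun := φ
           map_one' := hχ (by simp only [hφ, map_one])
           map_mul' := fun y z => hχ (by simp only [hφ, map_mul]) }, MonoidHom.ext hφ⟩

end Monoid

theorem comp_inv_mem_characterAlgebra [Group X] [Group G] {χ : X →* G →* k} {f : G → k}
    (hf : f ∈ characterAlgebra χ) : (fun g => f g⁻¹) ∈ characterAlgebra χ := by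
  rw [← Subalgebra.mem_toSubmodule, toSubmodule_characterAlgebra] at hf
  induction hf using Submodule.span_induction with
  | mem f hf =>
    obtain ⟨x, rfl⟩ := hf
    convert coe_mem_characterAlgebra χ x⁻¹ using 1
    ext g
    have hx : χ x⁻¹ g * χ x g = 1 := by
      rw [← MonoidHom.mul_apply, ← map_mul, inv_mul_cancel, map_one, MonoidHom.one_apply]
    have hg : χ x g * χ x g⁻¹ = 1 := by rw [← map_mul, mul_inv_cancel, map_one]
    exact (left_inv_eq_right_inv hx hg).symm
  | zero => exact zero_mem (characterAlgebra χ)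
  | add f f' _ _ hf hf' => exact add_mem hf hf'
  | smul c f _ hf => exact (characterAlgebra χ).smul_mem hf c

end CharacterAlgebra

section TorusCharacters

variable {k : Type*} [Field k] {r : ℕ}

variable (k r) in
/-- The characters `torusCharacter m` of the torus, with values in `k` instead of `kˣ`, as a
homomorphism from `ℤ^r` to the group of characters. -/
def torusCharacterHom : Multiplicative (Fin r → ℤ) →* (Fin r → kˣ) →* k where
  toFun m :=
    { toFun := fun t => (torusCharacter m.toAdd t : k)
      map_one' := by simp [torusCharacter]
      map_mul' := by simp [torusCharacter, mul_zpow, Finset.prod_mul_distrib] }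
  map_one' := by ext; simp [torusCharacter]
  map_mul' m n := by ext; simp [torusCharacter, zpow_add, Finset.prod_mul_distrib]

theorem exists_units_pow_ne_one [Infinite k] {d : ℕ} (hd : d ≠ 0) : ∃ u : kˣ, u ^ d ≠ 1 := by
  by_contra! hall
  have hpoly : (Polynomial.X ^ (d + 1) : Polynomial k) = Polynomial.X := by
    refine Polynomial.funext fun a => ?_
    obtain rfl | ha := eq_or_ne a 0
    · simp
    · have hpow : a ^ d = 1 := by simpa using congrArg Units.val (hall (Units.mk0 a ha))
      simp [pow_succ, hpow]
  have hdeg := congrArg Polynomial.natDegree hpoly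
  rw [Polynomial.natDegree_X_pow, Polynomial.natDegree_X] at hdeg
  lia

theorem eq_of_forall_units_zpow_eq [Infinite k] {m n : ℤ} (hmn : ∀ u : kˣ, u ^ m = u ^ n) :
    m = n := by
  by_contra hne
  obtain ⟨u, hu⟩ := exists_units_pow_ne_one (k := k) (Int.natAbs_ne_zero.2 (sub_ne_zero.2 hne))
  exact hu (by rw [pow_natAbs_eq_one, zpow_sub, hmn, mul_inv_cancel])

theorem torusCharacterHom_injective [Infinite k] :
    Function.Injective (torusCharacterHom k r) := by
  classical
  have hsingle (m : Multiplicative (Fin r → ℤ)) (i : Fin r) (u : kˣ) :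
      torusCharacterHom k r m (Pi.mulSingle i u) = (u ^ m.toAdd i : kˣ) := by
    refine congrArg Units.val ((Finset.prod_eq_single i ?_ (by simp)).trans (by simp))
    simp +contextual [Pi.mulSingle_eq_of_ne]
  intro m n hmn
  refine Multiplicative.toAdd.injective (funext fun i =>
    eq_of_forall_units_zpow_eq (k := k) fun u => ?_)
  exact Units.ext (by rw [← hsingle, ← hsingle, hmn])

theorem torusRegularFunctions_eq_characterAlgebra :
    torusRegularFunctions k r = characterAlgebra (torusCharacterHom k r) := by
  classical
  apply le_antisymm
  · have hcoord (i : Fin r) (c : ℤ) :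
        (fun t : Fin r → kˣ => (t i : k) ^ c) ∈ characterAlgebra (torusCharacterHom k r) := by
      convert coe_mem_characterAlgebra (torusCharacterHom k r) (.ofAdd (Pi.single i c)) using 1
      ext t
      rw [← Units.val_zpow_eq_zpow_val]
      refine congrArg Units.val ((Finset.prod_eq_single i ?_ (by simp)).trans (by simp)).symm
      simp +contextual [Pi.single_eq_of_ne]
    refine Algebra.adjoin_le ?_
    rintro _ (⟨i, rfl⟩ | ⟨i, rfl⟩)
    · simpa using hcoord i 1
    · simpa using hcoord i (-1)
  · rw [← Subalgebra.toSubmodule.le_iff_le, toSubmodule_characterAlgebra, Submodule.span_le]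
    rintro _ ⟨m, rfl⟩
    have hcoe (i : Fin r) : (fun t : Fin r → kˣ => (t i : k)) ∈ torusRegularFunctions k r :=
      Algebra.subset_adjoin (Or.inl ⟨i, rfl⟩)
    have hinv (i : Fin r) : (fun t : Fin r → kˣ => (t i : k)⁻¹) ∈ torusRegularFunctions k r :=
      Algebra.subset_adjoin (Or.inr ⟨i, rfl⟩)
    have hcoord (i : Fin r) (c : ℤ) :
        (fun t : Fin r → kˣ => (t i : k) ^ c) ∈ torusRegularFunctions k r := by
      obtain ⟨n, rfl | rfl⟩ := c.eq_nat_or_neg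
      · simp only [zpow_natCast]
        exact pow_mem (hcoe i) n
      · simp only [zpow_neg, zpow_natCast, ← inv_pow]
        exact pow_mem (hinv i) n
    have hprod : (torusCharacterHom k r m : (Fin r → kˣ) → k) =
        ∏ i, fun t : Fin r → kˣ => (t i : k) ^ m.toAdd i := by
      ext t
      simp [torusCharacterHom, torusCharacter]
    simp only [SetLike.mem_coe, Subalgebra.mem_toSubmodule, hprod]
    exact prod_mem fun i _ => hcoord i _

end TorusCharacters

section Zariski

variable {k X : Type*} [Field k]

/-- The Zariski topology attached to an algebra `R` of functions: the coarsest one in which the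
non-vanishing loci of the elements of `R` are open. By definition `glZariski k V` is the case
`R = glRegularFunctions k V`. -/
@[reducible]
def functionZariski (R : Subalgebra k (X → k)) : TopologicalSpace X :=
  TopologicalSpace.generateFrom {U | ∃ f ∈ R, U = {x | f x ≠ 0}}

theorem isTopologicalBasis_functionZariski (R : Subalgebra k (X → k)) :
    letI := functionZariski R
    TopologicalSpace.IsTopologicalBasis {U : Set X | ∃ f ∈ R, U = {x | f x ≠ 0}} := by
  let := functionZariski R
  have huniv : insert Set.univ {U : Set X | ∃ f ∈ R, U = {x | f x ≠ 0}} =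
      {U : Set X | ∃ f ∈ R, U = {x | f x ≠ 0}} :=
    Set.insert_eq_of_mem ⟨1, one_mem R, by simp⟩
  rw [← huniv]
  refine TopologicalSpace.isTopologicalBasis_of_subbasis_of_inter rfl ?_
  rintro _ ⟨f, hf, rfl⟩ _ ⟨f', hf', rfl⟩
  exact ⟨f * f', mul_mem hf hf', by ext; simp⟩

theorem preirreducibleSpace_functionZariski (R : Subalgebra k (X → k)) [NoZeroDivisors R] :
    letI := functionZariski R
    PreirreducibleSpace X := by
  let := functionZariski R
  refine ⟨fun U U' hU hU' ⟨x, _, hxU⟩ ⟨x', _, hxU'⟩ => ?_⟩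
  have hbasis := isTopologicalBasis_functionZariski R
  obtain ⟨_, ⟨f, hf, rfl⟩, hfx, hfU⟩ := hbasis.exists_subset_of_mem_open hxU hU
  obtain ⟨_, ⟨f', hf', rfl⟩, hfx', hfU'⟩ := hbasis.exists_subset_of_mem_open hxU' hU'
  have hne : (⟨f, hf⟩ * ⟨f', hf'⟩ : R) ≠ 0 :=
    mul_ne_zero (fun h0 => hfx (congrFun (congrArg Subtype.val h0) x))
      (fun h0 => hfx' (congrFun (congrArg Subtype.val h0) x'))
  obtain ⟨y, hy⟩ := Function.ne_iff.1 (Subtype.coe_injective.ne hne)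
  exact ⟨y, trivial, hfU (left_ne_zero_of_mul hy), hfU' (right_ne_zero_of_mul hy)⟩

variable {A : Type*} [Ring A] [Algebra k A]

theorem mem_autIdentityComponent_of_forall_comp_mem {V : Submodule k A} (hV : AutInvariant V)
    (R : Subalgebra k (X → k)) [NoZeroDivisors R] {γ : X → A ≃ₐ[k] A}
    (hγ : ∀ f ∈ autRegularFunctions hV, f ∘ γ ∈ R) {x₀ : X} (hx₀ : γ x₀ = 1) (x : X) :
    γ x ∈ autIdentityComponent hV := by
  let := functionZariski R
  let := autZariski hV
  have := preirreducibleSpace_functionZariski R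
  have hcont : Continuous γ := by
    rw [continuous_induced_rng, continuous_generateFrom_iff]
    rintro _ ⟨F, hF, rfl⟩
    exact TopologicalSpace.isOpen_generateFrom_of_mem ⟨_, hγ _ ⟨F, hF, rfl⟩, rfl⟩
  exact (isPreconnected_range hcont).subset_connectedComponent ⟨x₀, hx₀⟩ ⟨x, rfl⟩

end Zariski

section RegularPullback

variable {k V : Type*} [Field k] [AddCommGroup V] [Module k V] [FiniteDimensional k V]

theorem det_comp_mem_of_forall_coefficient_mem {X : Type*} {R : Subalgebra k (X → k)}
    {ρ : X → V →ₗ[k] V} (hρ : ∀ (ξ : Module.Dual k V) (v : V), (fun g => ξ (ρ g v)) ∈ R) :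
    (fun g => LinearMap.det (ρ g)) ∈ R := by
  classical
  let b := Module.finBasis k V
  have hdet : (fun g => LinearMap.det (ρ g)) =
      ∑ σ : Equiv.Perm (Fin (Module.finrank k V)),
        Equiv.Perm.sign σ • ∏ i, fun g => b.coord (σ i) (ρ g (b i)) := by
    ext g
    rw [← LinearMap.det_toMatrix b, Matrix.det_apply, Finset.sum_apply]
    exact Finset.sum_congr rfl fun σ _ => by simp [LinearMap.toMatrix_apply]
  rw [hdet]
  refine sum_mem fun σ _ => ?_
  rw [Units.smul_def]
  exact zsmul_mem (prod_mem fun i _ => hρ _ _) _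

variable {G : Type*} [Group G] {R : Subalgebra k (G → k)}

theorem comp_mem_of_mem_glRegularFunctions (hR : ∀ f ∈ R, (fun g => f g⁻¹) ∈ R)
    {ρ : G →* V ≃ₗ[k] V} (hρ : ∀ (ξ : Module.Dual k V) (v : V), (fun g => ξ (ρ g v)) ∈ R)
    {F : (V ≃ₗ[k] V) → k} (hF : F ∈ glRegularFunctions k V) : F ∘ ρ ∈ R := by
  induction hF using Algebra.adjoin_induction with
  | mem F hF =>
    obtain ⟨ξ, v, rfl⟩ | rfl := hF
    · exact hρ ξ v
    · convert hR _ (det_comp_mem_of_forall_coefficient_mem hρ) using 1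
      ext g
      rw [map_inv]
      exact (LinearEquiv.det_coe_symm (ρ g)).symm
  | algebraMap c => exact algebraMap_mem R c
  | add F F' _ _ hF hF' => exact add_mem hF hF'
  | mul F F' _ _ hF hF' => exact mul_mem hF hF'

theorem comp_mem_of_mem_autRegularFunctions {A : Type*} [Ring A] [Algebra k A]
    {V : Submodule k A} [FiniteDimensional k V] (hV : AutInvariant V)
    (hR : ∀ f ∈ R, (fun g => f g⁻¹) ∈ R) {γ : G →* A ≃ₐ[k] A}
    (hγ : ∀ (ξ : Module.Dual k A) (a : A), (fun g => ξ (γ g a)) ∈ R)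
    {f : (A ≃ₐ[k] A) → k} (hf : f ∈ autRegularFunctions hV) : f ∘ γ ∈ R := by
  obtain ⟨F, hF, rfl⟩ := hf
  refine comp_mem_of_mem_glRegularFunctions hR (ρ := (autRestrict hV).comp γ) (fun ξ v => ?_) hF
  obtain ⟨η, rfl⟩ := LinearMap.exists_extend ξ
  exact hγ η v

end RegularPullback

/-- The linear representation underlying an action by algebra automorphisms. -/
abbrev automorphismRepresentation {k G A : Type*} [Field k] [Monoid G] [Ring A] [Algebra k A]
    (γ : G →* (A ≃ₐ[k] A)) : Representation k G A :=
  (AlgEquiv.toLinearMapHom k A).comp γ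

section GradingAction

variable {k Γ A : Type*} [Field k] [AddCommMonoid Γ] [DecidableEq Γ] [Ring A] [Algebra k A]
  (𝒢 : Γ → Submodule k A) [GradedAlgebra 𝒢]

/-- The algebra endomorphism acting on each component of a graded algebra as a scalar, depending
multiplicatively on the degree. -/
noncomputable def gradingScaling (c : Multiplicative Γ →* k) : A →ₐ[k] A :=
  (DirectSum.toAlgebra k (fun n => 𝒢 n) (fun n => c (.ofAdd n) • (𝒢 n).subtype)
    (by simp) (fun a b => by simp [smul_smul, mul_comm])).comp
      (DirectSum.decomposeAlgEquiv 𝒢).toAlgHom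

variable {𝒢} in
theorem gradingScaling_of_mem (c : Multiplicative Γ →* k) {n : Γ} {a : A} (ha : a ∈ 𝒢 n) :
    gradingScaling 𝒢 c a = c (.ofAdd n) • a := by
  lift a to 𝒢 n using ha
  simpa [gradingScaling] using
    DirectSum.toSemiring_of (fun n => (c (.ofAdd n) • (𝒢 n).subtype).toAddMonoidHom) _ _ n a

theorem algHom_ext_of_forall_mem {f f' : A →ₐ[k] A} (hf : ∀ n, ∀ a ∈ 𝒢 n, f a = f' a) : f = f' :=
  AlgHom.toLinearMap_injective (DirectSum.decompose_lhom_ext 𝒢 fun n =>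
    LinearMap.ext fun a => hf n a a.2)

variable {G : Type*} [Group G] (χ : Multiplicative Γ →* G →* k)

/-- The action by algebra automorphisms on a `Γ`-graded algebra of a group `G` whose characters are
indexed by `Γ`: on the component of degree `n`, it is given by the character `χ n`. -/
noncomputable def gradingAction : G →* (A ≃ₐ[k] A) :=
  (AlgEquiv.algHomUnitsEquiv k A).toMonoidHom.comp <| MonoidHom.toHomUnits
    { toFun := fun g => gradingScaling 𝒢 (χ.flip g)
      map_one' := algHom_ext_of_forall_mem 𝒢 fun n a ha => by
        simp [gradingScaling_of_mem _ ha]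
      map_mul' := fun g g' => algHom_ext_of_forall_mem 𝒢 fun n a ha => by
        simp [gradingScaling_of_mem _ ha, smul_smul, mul_comm] }

variable {𝒢}

theorem gradingAction_of_mem (g : G) {n : Γ} {a : A} (ha : a ∈ 𝒢 n) :
    gradingAction 𝒢 χ g a = χ (.ofAdd n) g • a :=
  gradingScaling_of_mem _ ha

theorem gradingAction_coefficient_mem (ξ : Module.Dual k A) (a : A) :
    (fun g => ξ (gradingAction 𝒢 χ g a)) ∈ characterAlgebra χ := by
  induction a using DirectSum.Decomposition.inductionOn 𝒢 with
  | zero =>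
    simp only [map_zero]
    exact zero_mem (characterAlgebra χ)
  | add a a' ha ha' =>
    simp only [map_add]
    exact add_mem ha ha'
  | @homogeneous n a =>
    simp only [gradingAction_of_mem χ _ a.2, map_smul, smul_eq_mul, mul_comm _ (ξ a)]
    exact (characterAlgebra χ).smul_mem (coe_mem_characterAlgebra χ (.ofAdd n)) (ξ a)

variable (𝒢) in
theorem eq_characterSpace_gradingAction {χ : Multiplicative Γ →* G →* k}
    (hχ : Function.Injective χ) (n : Γ) :
    𝒢 n = characterSpace (automorphismRepresentation (gradingAction 𝒢 χ)) (χ (.ofAdd n)) := by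
  have hle : 𝒢 ≤ fun n => characterSpace
      (automorphismRepresentation (gradingAction 𝒢 χ)) (χ (.ofAdd n)) :=
    fun n a ha => mem_characterSpace.2 fun g => gradingAction_of_mem χ g ha
  have hindep := iSupIndep_characterSpace (automorphismRepresentation (gradingAction 𝒢 χ))
    (hχ.comp Multiplicative.ofAdd.injective)
  have htop := (DirectSum.Decomposition.isInternal 𝒢).submodule_iSup_eq_top
  exact congrFun ((hindep.le_iff_eq_of_iSup_eq_top htop).1 hle) n

end GradingAction

namespace FewAutomorphisms

variable {k A : Type*} [Field k] [Ring A] [Algebra k A] (h : FewAutomorphisms k A)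

theorem canonical_eq_characterSpace (m : Fin h.r → ℤ) :
    h.canonical m = characterSpace (automorphismRepresentation h.torus)
      (torusCharacterHom k h.r (.ofAdd m)) := by
  ext a
  rw [mem_characterSpace]
  rfl

theorem iSupIndep_canonical [Infinite k] : iSupIndep h.canonical := by
  simp only [funext h.canonical_eq_characterSpace]
  exact iSupIndep_characterSpace _
    (torusCharacterHom_injective.comp Multiplicative.ofAdd.injective)

theorem iSup_canonical [Infinite k] : ⨆ m, h.canonical m = ⊤ := by
  refine eq_top_iff.2 fun a _ => ?_
  obtain ⟨W, haW, _, hW, hreg⟩ := h.rational a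
  simp only [h.canonical_eq_characterSpace]
  refine mem_iSup_characterSpace _
    (torusCharacterHom_injective.comp Multiplicative.ofAdd.injective) W
    (fun t => hW (h.torus t) a haW) fun ξ => ?_
  have hcoeff := (h.torus_regular _).2 ⟨_, hreg a haW ξ, rfl⟩
  rwa [torusRegularFunctions_eq_characterAlgebra, ← Subalgebra.mem_toSubmodule,
    toSubmodule_characterAlgebra] at hcoeff

instance canonical_gradedMonoid : SetLike.GradedMonoid h.canonical where
  one_mem t := by simp [torusCharacter]
  mul_mem m n a b ha hb t := by
    rw [map_mul, ha t, hb t, smul_mul_smul_comm, ← Units.val_mul]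
    simp [torusCharacter, zpow_add, Finset.prod_mul_distrib]

theorem nonempty_gradedAlgebra_canonical [Infinite k] : Nonempty (GradedAlgebra h.canonical) :=
  ⟨(DirectSum.isInternal_submodule_of_iSupIndep_of_iSup_eq_top
    h.iSupIndep_canonical h.iSup_canonical).gradedAlgebra⟩

variable {G : Type*} [Group G]

theorem exists_torus_comp_eq {γ : G →* (A ≃ₐ[k] A)}
    (hγ : ∀ g, γ g ∈ autIdentityComponent h.invariant) :
    ∃ θ : G →* (Fin h.r → kˣ), ∀ g, h.torus (θ g) = γ g := by
  have hmem (g : G) : γ g ∈ h.torus.range := by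
    rw [← SetLike.mem_coe, MonoidHom.coe_range, h.range_torus]
    exact hγ g
  exact ⟨(MonoidHom.ofInjective h.torus_injective).symm.toMonoidHom.comp (γ.codRestrict _ hmem),
    fun g => MonoidHom.apply_ofInjective_symm h.torus_injective ⟨_, hmem g⟩⟩

variable {Γ : Type*} [AddCommGroup Γ] [DecidableEq Γ] [UniqueSums Γ]

theorem exists_forall_canonical_le {χ : Multiplicative Γ →* G →* k} (hχ : Function.Injective χ)
    (𝒢 : Γ → Submodule k A) [GradedAlgebra 𝒢] :
    ∃ φ : (Fin h.r → ℤ) →+ Γ, ∀ m, h.canonical m ≤ 𝒢 (φ m) := by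
  have := h.finiteDimensional
  have := noZeroDivisors_characterAlgebra hχ
  have hpull {f : (A ≃ₐ[k] A) → k} (hf : f ∈ autRegularFunctions h.invariant) :
      f ∘ gradingAction 𝒢 χ ∈ characterAlgebra χ :=
    comp_mem_of_mem_autRegularFunctions h.invariant (fun _ => comp_inv_mem_characterAlgebra)
      (gradingAction_coefficient_mem χ) hf
  obtain ⟨θ, hθ⟩ := h.exists_torus_comp_eq fun g =>
    mem_autIdentityComponent_of_forall_comp_mem h.invariant (characterAlgebra χ)
      (fun _ => hpull) (map_one (gradingAction 𝒢 χ)) g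
  have hchar (m : Multiplicative (Fin h.r → ℤ)) :
      ((torusCharacterHom k h.r m).comp θ : G → k) ∈ characterAlgebra χ := by
    have hm := coe_mem_characterAlgebra (torusCharacterHom k h.r) m
    rw [← torusRegularFunctions_eq_characterAlgebra, h.torus_regular] at hm
    obtain ⟨f, hf, hfm⟩ := hm
    convert hpull hf using 1
    ext g
    simp [hfm, hθ]
  obtain ⟨φ, hφ⟩ := exists_comp_eq_of_forall_mem_characterAlgebra hχ
    (η := (MonoidHom.compHom' θ).comp (torusCharacterHom k h.r)) hchar
  refine ⟨AddMonoidHom.toMultiplicative.symm φ, fun m a ha => ?_⟩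
  rw [eq_characterSpace_gradingAction 𝒢 hχ, mem_characterSpace]
  intro g
  have hφg : χ (φ (.ofAdd m)) g = torusCharacter m (θ g) :=
    DFunLike.congr_fun (DFunLike.congr_fun hφ (.ofAdd m)) g
  calc gradingAction 𝒢 χ g a = h.torus (θ g) a := by rw [hθ]
    _ = (torusCharacter m (θ g) : k) • a := ha (θ g)
    _ = χ (φ (.ofAdd m)) g • a := by rw [hφg]

end FewAutomorphisms

theorem theorem2p2_general {k : Type*} [Field k] [Infinite k] {A : Type*} [Ring A] [Algebra k A]
    (h : FewAutomorphisms k A) :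
    Nonempty (GradedAlgebra h.canonical) ∧
    ∀ {Γ G : Type*} [AddCommGroup Γ] [DecidableEq Γ] [UniqueSums Γ] [Group G]
      (χ : Multiplicative Γ →* G →* k), Function.Injective χ →
      ∀ (𝒢 : Γ → Submodule k A) [GradedAlgebra 𝒢], ∃ φ : (Fin h.r → ℤ) →+ Γ, ∀ n : Γ,
        IsDirectSumOf (𝒢 n) (fun m : {m : Fin h.r → ℤ // φ m = n} => h.canonical m) := by
  refine ⟨h.nonempty_gradedAlgebra_canonical, fun χ hχ 𝒢 _ => ?_⟩
  obtain ⟨φ, hφ⟩ := h.exists_forall_canonical_le hχ 𝒢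
  have hindep : iSupIndep 𝒢 := (DirectSum.Decomposition.isInternal 𝒢).submodule_iSupIndep
  exact ⟨φ, fun n => ⟨h.iSupIndep_canonical.comp Subtype.val_injective,
    eq_iSup_fiber_of_le h.iSup_canonical hindep hφ n⟩⟩

theorem theorem2p2 {k : Type*} [Field k] [CharZero k] {A : Type*} [Ring A] [Algebra k A]
    (h : FewAutomorphisms k A) :
    Nonempty (GradedAlgebra h.canonical) ∧
    ∀ (t : ℕ) (𝒢 : (Fin t → ℤ) → Submodule k A) [GradedAlgebra 𝒢],
      ∃ φ : (Fin h.r → ℤ) →+ (Fin t → ℤ),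
        ∀ n : Fin t → ℤ,
          IsDirectSumOf (𝒢 n) (fun m : {m : Fin h.r → ℤ // φ m = n} => h.canonical m) := by
  have : Infinite k := CharZero.infinite k
  exact (theorem2p2_general h).imp_right fun hrefine t =>
    hrefine (torusCharacterHom k t) torusCharacterHom_injective
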